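/- Fix an integer $k\ge 1$ and let $f(x)=x^k$, $\gamma_k(x)=(x,x^k)$. For points $p_i=(x_i,y_i)$ listed with nondecreasing $x$-coordinates, in which a point of the graph of $f$ may be repeated, divided differences are defined by $\Delta_0(p_i)=y_i$, by $$\Delta_j(p_i,\dots,p_{i+j})=\frac{\Delta_{j-1}(p_{i+1},\dots,p_{i+j})-\Delta_{j-1}(p_i,\dots,p_{i+j-1})}{x_{i+j}-x_i}$$ if $x_i<x_{i+j}$, and by $f^{(j)}(x_i)/j!$ if $p_i=\dots=p_{i+j}$ lies on the graph of $f$. For $a<b$ in $[0,\infty)$, a sequence $(p_1,\dots,p_m)$ of points whose $x$-coordinates satisfy $a<x_1<\dots<x_m<b$ is called admissible for $(a,b)$ if every $(k+1)$-element subtuple of the multiset chain $$(\underbrace{\gamma_k(a),\dots,\gamma_k(a)}_{k},p_1,\dots,p_m,\underbrace{\gamma_k(b),\dots,\gamma_k(b)}_{k})$$ has nonnegative $k$-th divided difference, i.e. if this is a $k$-monotone chain. Let $L^k_n$ be the maximal length $m$ of a sequence admissible for $(0,1)$ consisting of points of $X_n$, where $X_n$ is a set of $n$ independent uniform random points of $[0,1]^2$.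 Let $\Pi$ be a homogeneous Poisson process of intensity $1$ in the plane, and let $L^k(0,n)$ be the maximal length of a sequence admissible for $(0,n)$ consisting of points of $\Pi\cap C_k(0,n)$. Here $C_k(a,b)$ is the set of points $(x,y)$ with $a\le x\le b$ and, writing $\Phi_c(x)=x^k-(x-c)^k$ and $\Psi_{c,d}(x)=x^k-(x-c)^{k-1}(x-d)$, $$\max\{\Phi_a(x),\Phi_b(x)\}\le y\le\min\{\Psi_{a,b}(x),\Psi_{b,a}(x)\}\quad\text{if $k$ is even},$$ $$\max\{\Phi_a(x),\Psi_{b,a}(x)\}\le y\le\min\{\Psi_{a,b}(x),\Phi_b(x)\}\quad\text{if $k$ is odd}.$$ Then for all sufficiently large integers $n$, $$\mathbb E L^k_n\ \ge\ \tfrac16\,n^{1/(k+1)}\qquad\text{and}\qquad \mathbb E L^k(0,n)\ \ge\ \tfrac n6 .$$ In particular, the limiting constant $\alpha_k$ satisfies $\alpha_k\ge\frac16$, both as the constant of the uniform model, $\alpha_k=\lim_{n\to\infty} n^{-1/(k+1)}\,\mathbb E L^k_n$, and as the constant of the Poisson model, $\alpha_k=\lim_{n\to\infty}n^{-1}\,\mathbb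 E L^k(0,n)$: any number that is one of these limits is at least $\frac16$. -/

import Mathlib

open MeasureTheory ProbabilityTheory Filter Topology
open scoped ENNReal NNReal Nat

noncomputable section

namespace KMonotone

/-- The divided difference `Δ_j(p_i, …, p_{i+j})`, with respect to `f`, of consecutive terms of a
sequence `p` of points of the plane listed with nondecreasing `x`-coordinates. Points that are
repeated lie on the graph of `f`. If the first and the last `x`-coordinate coincide (so that all the
points are one and the same point `(x, f x)`), the value is `f^{(j)}(x) / j!`; otherwise it is given
by the usual recursion. -/
def dividedDiff (f : ℝ → ℝ) (p : ℕ → ℝ × ℝ) : ℕ → ℕ → ℝ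
  | 0, i => (p i).2
  | j + 1, i =>
    if (p (i + j + 1)).1 = (p i).1 then
      iteratedDeriv (j + 1) f (p i).1 / ((j + 1)! : ℝ)
    else
      (dividedDiff f p j (i + 1) - dividedDiff f p j i) / ((p (i + j + 1)).1 - (p i).1)

/-- A `(k+1)`-tuple, written as a list of length `k + 1` (repetitions allowed, for points on the
graph of `f`), is positive with respect to `f` if its `k`-th divided difference is nonnegative. -/
def IsPositive (k : ℕ) (f : ℝ → ℝ) (l : List (ℝ × ℝ)) : Prop :=
  l.length = k + 1 ∧ 0 ≤ dividedDiff f (fun i => l.getD i 0) k 0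

/-- The point `γ_k(x) = (x, x ^ k)`. -/
def gam (k : ℕ) (x : ℝ) : ℝ × ℝ := (x, x ^ k)

/-- The multiset chain `(γ_k(a)^{∘k}, p_1, …, p_m, γ_k(b)^{∘k})`. -/
def extendedChain (k : ℕ) (a b : ℝ) (l : List (ℝ × ℝ)) : List (ℝ × ℝ) :=
  List.replicate k (gam k a) ++ l ++ List.replicate k (gam k b)

/-- `(γ_k(a)^{∘k}, p_1, …, p_m, γ_k(b)^{∘k})` is a `k`-monotone chain: the `x`-coordinates of
`γ_k(a), p_1, …, p_m, γ_k(b)` increase, and every `(k+1)`-element subtuple of the multiset chain is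
positive with respect to `x ↦ x ^ k`. -/
def IsKMonotone (k : ℕ) (a b : ℝ) (l : List (ℝ × ℝ)) : Prop :=
  (gam k a :: (l ++ [gam k b])).Pairwise (fun p q => p.1 < q.1) ∧
    ∀ t : List (ℝ × ℝ), t.Sublist (extendedChain k a b l) → t.length = k + 1 →
      IsPositive k (fun x => x ^ k) t

/-- The maximal cardinality of a chain `(p_1, …, p_m)` of points of `S` for which
`(γ_k(a)^{∘k}, p_1, …, p_m, γ_k(b)^{∘k})` is a `k`-monotone chain. -/
def longest (k : ℕ) (a b : ℝ) (S : Set (ℝ × ℝ)) : ℕ∞ :=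
  ⨆ (l : List (ℝ × ℝ)) (_ : (∀ p ∈ l, p ∈ S) ∧ IsKMonotone k a b l), (l.length : ℕ∞)

/-- `Φ_k(a)(x) = x^k - (x-a)^k`. -/
def PhiPoly (k : ℕ) (a x : ℝ) : ℝ := x ^ k - (x - a) ^ k

/-- `Ψ_k(a,b)(x) = x^k - (x-a)^{k-1} (x-b)`, for `k ≥ 1`. -/
def PsiPoly (k : ℕ) (a b x : ℝ) : ℝ := x ^ k - (x - a) ^ (k - 1) * (x - b)

/-- The cell `C_k(a,b)`, for `k ≥ 1`. For even `k` it lies above the graphs of `Φ_k(a)`, `Φ_k(b)`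
and below those of `Ψ_k(a,b)`, `Ψ_k(b,a)`; for odd `k` it lies above `Φ_k(a)`, `Ψ_k(b,a)` and below
`Ψ_k(a,b)`, `Φ_k(b)`. For `k = 1` this is the square `[a,b]²`. -/
def cell (k : ℕ) (a b : ℝ) : Set (ℝ × ℝ) :=
  {p | a ≤ p.1 ∧ p.1 ≤ b ∧
    (if Even k then
      max (PhiPoly k a p.1) (PhiPoly k b p.1) ≤ p.2 ∧
        p.2 ≤ min (PsiPoly k a b p.1) (PsiPoly k b a p.1)
    else
      max (PhiPoly k a p.1) (PsiPoly k b a p.1) ≤ p.2 ∧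
        p.2 ≤ min (PsiPoly k a b p.1) (PhiPoly k b p.1))}

/-- `E L^k_n`: the expectation of the maximal cardinality of a chain in `M^k(X_n)`, where `X_n`
consists of `n` independent uniform points of the unit square `[0,1]²`. -/
def expUniform (k n : ℕ) : ℝ≥0∞ :=
  ∫⁻ X : Fin n → ℝ × ℝ, (longest k 0 1 (Set.range X) : ℝ≥0∞)
    ∂(Measure.pi fun _ : Fin n => (volume : Measure (ℝ × ℝ)).restrict (Set.Icc 0 1 ×ˢ Set.Icc 0 1))

/-- `Pts` is a homogeneous Poisson process of intensity `1` in the plane: a random set whose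
numbers of points in Borel sets are random variables, Poisson distributed with parameter the area
of the set (when finite), and independent for disjoint sets. -/
structure IsPoissonProcess {Ω : Type*} [MeasurableSpace Ω] (P : Measure Ω)
    (Pts : Ω → Set (ℝ × ℝ)) : Prop where
  measurable_count : ∀ A : Set (ℝ × ℝ), MeasurableSet A →
    Measurable fun ω => (Pts ω ∩ A).encard
  poisson_count : ∀ A : Set (ℝ × ℝ), MeasurableSet A → volume A ≠ ∞ → ∀ j : ℕ,
    P {ω | (Pts ω ∩ A).encard = (j : ℕ∞)} =
      ENNReal.ofReal (Real.exp (-(volume A).toReal) * (volume A).toReal ^ j / (j ! : ℝ))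
  indep_count : ∀ A : ℕ → Set (ℝ × ℝ), (∀ i, MeasurableSet (A i)) →
    Pairwise (fun i j => Disjoint (A i) (A j)) →
    iIndepFun (fun i ω => (Pts ω ∩ A i).encard) P

/-- `E L^k(a,b)`: the expectation of the maximal cardinality of a chain of points of
`Pts ∩ C_k(a,b)` which forms a `k`-monotone chain with `γ_k(a)^{∘k}` and `γ_k(b)^{∘k}`. -/
def expPoisson {Ω : Type*} [MeasurableSpace Ω] (P : Measure Ω) (Pts : Ω → Set (ℝ × ℝ))
    (k : ℕ) (a b : ℝ) : ℝ≥0∞ :=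
  ∫⁻ ω, (longest k a b (Pts ω ∩ cell k a b) : ℝ≥0∞) ∂P

end KMonotone

end

/-! Cut the interval into m equal pieces and keep one sample point in each piece that offers a
suitable one. Chains over adjacent intervals concatenate, because k copies of `gam k b` separate
them and a window of k+1 consecutive terms cannot reach across (`WindowsPositive.merge`).
Consecutive windows control all subtuples, and terms may be deleted: leaving out a node replaces two
neighbouring divided differences by a convex combination of them
(`ChainOn.dividedDiff_skip_nonneg`). It therefore suffices to know when a single point is admissible
for (a,b), and `halfCell` is an explicit region of such points, of area (b-a)^(k+1)/(2^k k). When a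
piece has width 3 (in the uniform model, after rescaling), this area is at least 3/2, so a region is
empty with probability at most e^(-3/2) ≤ 1/3. Linearity of expectation gives at least 2m/3 points;
taking m ≥ n/4 (resp. n^(1/(k+1))/4) yields 1/6 and leaves room for rounding. -/

namespace KMonotone

/-! ### Divided differences -/

/-- The order in which the points of a multiset chain are listed: repetitions are allowed, but
distinct points have distinct `x`-coordinates. -/
def Precedes (p q : ℝ × ℝ) : Prop := p.1 < q.1 ∨ p = q

theorem Precedes.le {p q : ℝ × ℝ} (h : Precedes p q) : p.1 ≤ q.1 := by
  rcases h with h | rfl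
  · exact h.le
  · exact le_rfl

/-- The terms `p i, …, p (i + j)` are listed in the order `Precedes`. -/
def ChainOn (p : ℕ → ℝ × ℝ) (i j : ℕ) : Prop :=
  ∀ ⦃m n : ℕ⦄, i ≤ m → m ≤ n → n ≤ i + j → Precedes (p m) (p n)

theorem ChainOn.mono {p : ℕ → ℝ × ℝ} {i j i' j' : ℕ} (h : ChainOn p i j) (hi : i ≤ i')
    (hj : i' + j' ≤ i + j) : ChainOn p i' j' :=
  fun _ _ h1 h2 h3 => h (hi.trans h1) h2 (h3.trans hj)

theorem ChainOn.eq_of_fst_eq {p : ℕ → ℝ × ℝ} {i j : ℕ} (h : ChainOn p i j)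
    (e : (p (i + j)).1 = (p i).1) {n : ℕ} (hn : n ≤ j) : p (i + n) = p i := by
  rcases h le_rfl (Nat.le_add_right i n) (by omega) with h1 | h1
  · have := (h (Nat.le_add_right i n) (show i + n ≤ i + j by omega) le_rfl).le
    linarith
  · exact h1.symm

theorem dividedDiff_congr {f : ℝ → ℝ} {p q : ℕ → ℝ × ℝ} {j i i' : ℕ}
    (h : ∀ n ≤ j, p (i + n) = q (i' + n)) : dividedDiff f p j i = dividedDiff f q j i' := by
  induction j generalizing i i' with
  | zero => simpa [dividedDiff] using congrArg Prod.snd (h 0 le_rfl)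
  | succ j ih =>
    have h0 : p i = q i' := h 0 (by omega)
    have h1 : p (i + j + 1) = q (i' + j + 1) := h (j + 1) le_rfl
    have e0 : dividedDiff f p j i = dividedDiff f q j i' := ih fun n hn => h n (by omega)
    have e1 : dividedDiff f p j (i + 1) = dividedDiff f q j (i' + 1) := ih fun n hn => by
      have := h (n + 1) (by omega)
      rwa [show i + 1 + n = i + (n + 1) by omega, show i' + 1 + n = i' + (n + 1) by omega]
    simp only [dividedDiff, h0, h1, e0, e1]

/-- Clearing the denominator merges both branches of the recursion: if the end nodes coincide, all
nodes do, and both sides vanish. -/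
theorem ChainOn.mul_dividedDiff_succ {p : ℕ → ℝ × ℝ} {i j : ℕ} (h : ChainOn p i (j + 1))
    (f : ℝ → ℝ) :
    ((p (i + j + 1)).1 - (p i).1) * dividedDiff f p (j + 1) i =
      dividedDiff f p j (i + 1) - dividedDiff f p j i := by
  by_cases e : (p (i + j + 1)).1 = (p i).1
  · have : dividedDiff f p j (i + 1) = dividedDiff f p j i := dividedDiff_congr fun n hn => by
      rw [h.eq_of_fst_eq e (show n ≤ j + 1 by omega), show i + 1 + n = i + (n + 1) by omega,
        h.eq_of_fst_eq e (show n + 1 ≤ j + 1 by omega)]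
    rw [this, e]; ring
  · rw [dividedDiff, if_neg e]
    field_simp [sub_ne_zero.mpr e]

/-- The sequence `p` with the term of index `e` left out. -/
def skip (p : ℕ → ℝ × ℝ) (e n : ℕ) : ℝ × ℝ := if n < e then p n else p (n + 1)

theorem dividedDiff_skip_first (f : ℝ → ℝ) (p : ℕ → ℝ × ℝ) (k i : ℕ) :
    dividedDiff f (skip p i) k i = dividedDiff f p k (i + 1) :=
  dividedDiff_congr fun n _ => by
    rw [skip, if_neg (by omega), show i + 1 + n = i + n + 1 by omega]

theorem dividedDiff_skip_last (f : ℝ → ℝ) (p : ℕ → ℝ × ℝ) (k i : ℕ) :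
    dividedDiff f (skip p (i + k + 1)) k i = dividedDiff f p k i :=
  dividedDiff_congr fun n _ => by rw [skip, if_pos (by omega)]

theorem dividedDiff_skip {p : ℕ → ℝ × ℝ} {i k e : ℕ} (f : ℝ → ℝ) (h : ChainOn p i (k + 1))
    (hi : i ≤ e) (he : e ≤ i + k + 1) :
    dividedDiff f (skip p e) k i =
      dividedDiff f p k i + ((p (i + k + 1)).1 - (p e).1) * dividedDiff f p (k + 1) i := by
  rcases hi.eq_or_lt with rfl | hi'
  · rw [dividedDiff_skip_first, h.mul_dividedDiff_succ]; ring
  rcases he.eq_or_lt with rfl | he'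
  · rw [dividedDiff_skip_last]; ring
  induction k generalizing i with
  | zero => omega
  | succ k ih =>
    have hz := h.mul_dividedDiff_succ f
    have hy := (h.mono (i' := i) (j' := k + 1) le_rfl (by omega)).mul_dividedDiff_succ f
    by_cases E : (p (i + (k + 1) + 1)).1 = (p i).1
    · have h1 : dividedDiff f (skip p e) (k + 1) i = dividedDiff f p (k + 1) i :=
        dividedDiff_congr fun n hn => by
          have h2 := h.eq_of_fst_eq E (show n ≤ k + 1 + 1 by omega)
          have h3 := h.eq_of_fst_eq E (show n + 1 ≤ k + 1 + 1 by omega)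
          rw [skip]; split_ifs
          · rfl
          · rw [h2, ← h3]; rfl
      have h4 := h.eq_of_fst_eq E (show e - i ≤ k + 1 + 1 by omega)
      rw [show i + (e - i) = e by omega] at h4
      rw [h1, h4, E]; ring
    -- The identity is needed on both shorter windows, starting at i and i+1. There e may be an end
    -- node, a case outside the induction hypothesis.
    · have key : ∀ i', i ≤ i' → i' ≤ e → e ≤ i' + k + 1 → i' ≤ i + 1 →
          dividedDiff f (skip p e) k i' = dividedDiff f p k i' +
            ((p (i' + k + 1)).1 - (p e).1) * dividedDiff f p (k + 1) i' := by
        intro i' h1 h2 h3 h4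
        have hc : ChainOn p i' (k + 1) := h.mono h1 (by omega)
        rcases h2.eq_or_lt with rfl | h2'
        · rw [dividedDiff_skip_first, hc.mul_dividedDiff_succ]; ring
        rcases h3.eq_or_lt with rfl | h3'
        · rw [dividedDiff_skip_last]; ring
        exact ih hc h2 h3 h2' h3'
      have k0 := key i le_rfl hi (by omega) (by omega)
      have k1 := key (i + 1) (by omega) (by omega) (by omega) le_rfl
      have s1 : skip p e (i + k + 1) = p (i + (k + 1) + 1) := by
        rw [skip, if_neg (by omega)]; rfl
      have s0 : skip p e i = p i := by rw [skip, if_pos hi']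
      have E' : (p (i + (k + 1) + 1)).1 - (p i).1 ≠ 0 := sub_ne_zero.mpr E
      have hx : ((p (i + (k + 1) + 1)).1 - (p i).1) * dividedDiff f (skip p e) (k + 1) i =
          dividedDiff f (skip p e) k (i + 1) - dividedDiff f (skip p e) k i := by
        rw [dividedDiff, s1, s0, if_neg E]
        field_simp
      rw [k0, k1] at hx
      rw [show i + 1 + k + 1 = i + (k + 1) + 1 by omega] at hx
      apply mul_left_cancel₀ E'
      rw [hx]
      linear_combination ((p e).1 - (p (i + (k + 1) + 1)).1) * hz - hy

/-- The new difference is the average of the two old ones with weights proportional to the distances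
from node e to the first and to the last node. -/
theorem ChainOn.dividedDiff_skip_nonneg {f : ℝ → ℝ} {p : ℕ → ℝ × ℝ} {i k e : ℕ}
    (h : ChainOn p i (k + 1)) (hi : i ≤ e) (he : e ≤ i + k + 1)
    (h0 : 0 ≤ dividedDiff f p k i) (h1 : 0 ≤ dividedDiff f p k (i + 1)) :
    0 ≤ dividedDiff f (skip p e) k i := by
  have hs := dividedDiff_skip f h hi he
  have hB := h.mul_dividedDiff_succ f
  have l1 := (h le_rfl hi (by omega)).le
  have l2 := (h hi he (by omega)).le
  rcases (l1.trans l2).eq_or_lt with E | E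
  · rw [hs, show (p (i + k + 1)).1 = (p e).1 by linarith]
    simpa using h0
  · refine nonneg_of_mul_nonneg_right (a := (p (i + k + 1)).1 - (p i).1) ?_ (by linarith)
    have : ((p (i + k + 1)).1 - (p i).1) * dividedDiff f (skip p e) k i =
        ((p e).1 - (p i).1) * dividedDiff f p k i +
          ((p (i + k + 1)).1 - (p e).1) * dividedDiff f p k (i + 1) := by
      rw [hs]; linear_combination ((p (i + k + 1)).1 - (p e).1) * hB
    rw [this]
    have := mul_nonneg (sub_nonneg.2 l1) h0
    have := mul_nonneg (sub_nonneg.2 l2) h1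
    linarith

/-! ### Divided differences of powers and of one-node perturbations -/

theorem dividedDiff_add (f : ℝ → ℝ) (x y z : ℕ → ℝ) (j i : ℕ) :
    dividedDiff f (fun n => (x n, y n + z n)) j i =
      dividedDiff f (fun n => (x n, y n)) j i + dividedDiff 0 (fun n => (x n, z n)) j i := by
  induction j generalizing i with
  | zero => rfl
  | succ j ih =>
    simp only [dividedDiff, ih]
    split_ifs
    · simp
    · ring

theorem iteratedDeriv_pow_div_factorial (m j : ℕ) (x : ℝ) :
    iteratedDeriv j (fun x : ℝ => x ^ m) x / (j ! : ℝ) = m.choose j * x ^ (m - j) := by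
  rw [iteratedDeriv_eq_iterate, iter_deriv_pow, ← descPochhammer_eval_eq_prod_range,
    descPochhammer_eval_eq_descFactorial, Nat.descFactorial_eq_factorial_mul_choose]
  push_cast
  field_simp

theorem chainOn_graph {x : ℕ → ℝ} (hx : Monotone x) (f : ℝ → ℝ) (i j : ℕ) :
    ChainOn (fun n => (x n, f (x n))) i j := by
  intro m n _ hmn _
  rcases (hx hmn).lt_or_eq with h | h
  · exact Or.inl h
  · exact Or.inr (by simp only [h])

/-- Leibniz rule for the product x · x^m; at coinciding nodes it is Pascal's rule. -/
theorem dividedDiff_pow_succ {x : ℕ → ℝ} (hx : Monotone x) (m j i : ℕ) :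
    dividedDiff (fun x => x ^ (m + 1)) (fun n => (x n, x n ^ (m + 1))) (j + 1) i =
      x (i + j + 1) * dividedDiff (fun x => x ^ m) (fun n => (x n, x n ^ m)) (j + 1) i +
        dividedDiff (fun x => x ^ m) (fun n => (x n, x n ^ m)) j i := by
  have hB := fun i j => (chainOn_graph hx (fun x => x ^ m) i (j + 1)).mul_dividedDiff_succ
    (fun x => x ^ m)
  by_cases e : x (i + j + 1) = x i
  · have hc : ∀ n ≤ j, x (i + n) = x i := fun n hn =>
      le_antisymm (e ▸ hx (by omega)) (hx (by omega))
    have hd : dividedDiff (fun x => x ^ m) (fun n => (x n, x n ^ m)) j i =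
        iteratedDeriv j (fun x : ℝ => x ^ m) (x i) / (j ! : ℝ) := by
      cases j with
      | zero => simp [dividedDiff]
      | succ j =>
        have := hc (j + 1) le_rfl
        rw [← add_assoc] at this
        rw [dividedDiff, if_pos this]
    rw [hd, dividedDiff, dividedDiff, if_pos e, if_pos e]
    simp only [iteratedDeriv_pow_div_factorial, e]
    rw [Nat.choose_succ_succ, Nat.add_sub_add_right]
    rcases Nat.lt_or_ge j m with h | h
    · rw [show m - j = m - (j + 1) + 1 by omega]; push_cast; ring
    · rw [Nat.choose_eq_zero_of_lt (show m < j + 1 by omega)]; simp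
  · have e' : x (i + j + 1) - x i ≠ 0 := sub_ne_zero.mpr e
    have hx' := hB i j
    apply mul_left_cancel₀ e'
    rw [dividedDiff, if_neg e, mul_div_cancel₀ _ e']
    simp only at hx' ⊢
    cases j with
    | zero =>
      simp only [dividedDiff] at hx' ⊢
      simp only [add_zero, zero_add] at *
      rw [if_neg e] at *
      field_simp
      ring
    | succ j =>
      rw [dividedDiff_pow_succ hx m j i, dividedDiff_pow_succ hx m j (i + 1)]
      have h2 := hB i j
      simp only at h2
      rw [show i + 1 + j + 1 = i + (j + 1) + 1 by omega]
      rw [← add_assoc] at hx' ⊢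
      linear_combination (-x (i + j + 1 + 1)) * hx' - h2

theorem dividedDiff_pow_eq_zero {x : ℕ → ℝ} (hx : Monotone x) (m j i : ℕ) (h : m < j) :
    dividedDiff (fun x => x ^ m) (fun n => (x n, x n ^ m)) j i = 0 := by
  induction m generalizing j with
  | zero =>
    obtain ⟨j, rfl⟩ : ∃ j', j = j' + 1 := ⟨j - 1, by omega⟩
    clear h
    induction j generalizing i with
    | zero => simp [dividedDiff]
    | succ j ih =>
      rw [dividedDiff, ih, ih]; simp [iteratedDeriv_const]
  | succ m ih =>
    obtain ⟨j, rfl⟩ : ∃ j', j = j' + 1 := ⟨j - 1, by omega⟩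
    rw [dividedDiff_pow_succ hx, ih _ (by omega), ih _ (by omega)]; simp

theorem dividedDiff_pow_self {x : ℕ → ℝ} (hx : Monotone x) (m i : ℕ) :
    dividedDiff (fun x => x ^ m) (fun n => (x n, x n ^ m)) m i = 1 := by
  induction m with
  | zero => simp [dividedDiff]
  | succ m ih => rw [dividedDiff_pow_succ hx, ih, dividedDiff_pow_eq_zero hx _ _ _ (by omega)]; simp

theorem dividedDiff_zero_of_eq_zero {x z : ℕ → ℝ} {j i : ℕ} (h : ∀ n ≤ j, z (i + n) = 0) :
    dividedDiff 0 (fun n => (x n, z n)) j i = 0 := by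
  induction j generalizing i with
  | zero => exact h 0 le_rfl
  | succ j ih =>
    rw [dividedDiff, ih fun n hn => h n (by omega), ih fun n hn => by
      rw [show i + 1 + n = i + (n + 1) by omega]; exact h _ (by omega)]
    simp

/-- The divided difference of a function that vanishes at all nodes but `t`, where the nodes before
`t` are all equal to `a` and the nodes after `t` are all equal to `b`. -/
theorem dividedDiff_zero_single {x z : ℕ → ℝ} {a t b : ℝ} {e : ℕ} (hat : a < t) (htb : t < b)
    (ha : ∀ n < e, x n = a) (ht : x e = t) (hb : ∀ n, e < n → x n = b)
    (hz : ∀ n, n ≠ e → z n = 0) (r s i : ℕ) (hi : i + r = e) :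
    dividedDiff 0 (fun n => (x n, z n)) (r + s) i = z e / ((t - a) ^ r * (t - b) ^ s) := by
  induction hj : r + s generalizing r s i with
  | zero =>
    obtain ⟨rfl, rfl⟩ : r = 0 ∧ s = 0 := by omega
    simp [dividedDiff, ← hi]
  | succ j ih =>
    have h1 : t - a ≠ 0 := by linarith
    have h2 : t - b ≠ 0 := by linarith
    have h3 : b - a ≠ 0 := by linarith
    have h4 : b - t ≠ 0 := by linarith
    rw [dividedDiff]
    simp only
    -- If t is an end node, one of the two shorter windows misses it and contributes 0; otherwise
    -- the end nodes are a and b.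
    rcases Nat.eq_zero_or_pos r with rfl | hr
    · obtain rfl : i = e := by omega
      rw [hb (i + j + 1) (by omega), ht, if_neg (by linarith),
        dividedDiff_zero_of_eq_zero fun n hn => hz _ (by omega), ih 0 j i hi (by omega),
        show s = j + 1 by omega]
      field_simp
      ring
    obtain ⟨r, rfl⟩ : ∃ r', r = r' + 1 := ⟨r - 1, by omega⟩
    rw [ha i (by omega)]
    rcases Nat.eq_zero_or_pos s with rfl | hs
    · rw [show i + j + 1 = e by omega, ht, if_neg (by linarith), ih r 0 (i + 1) (by omega) (by omega),
        dividedDiff_zero_of_eq_zero fun n hn => hz _ (by omega)]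
      field_simp
      ring
    obtain ⟨s, rfl⟩ : ∃ s', s = s' + 1 := ⟨s - 1, by omega⟩
    rw [hb (i + j + 1) (by omega), if_neg (by linarith), ih r (s + 1) (i + 1) (by omega) (by omega),
      ih (r + 1) s i hi (by omega)]
    field_simp
    ring

end KMonotone
namespace KMonotone

/-! ### Chains -/

instance : IsTrans (ℝ × ℝ) Precedes where
  trans p q r h1 h2 := by
    rcases h1 with h1 | rfl
    · exact Or.inl (h1.trans_le h2.le)
    · exact h2

/-- All windows of length `k + 1` of a list are positive. -/
def WindowsPositive (k : ℕ) (f : ℝ → ℝ) (l : List (ℝ × ℝ)) : Prop :=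
  ∀ w : List (ℝ × ℝ), w <:+: l → w.length = k + 1 → IsPositive k f w

theorem chainOn_getD {l : List (ℝ × ℝ)} (h : l.Pairwise Precedes) {i j : ℕ}
    (hj : i + j < l.length) : ChainOn (fun n => l.getD n 0) i j := by
  intro m n _ hmn hn
  simp only [List.getD_eq_getElem l 0 (show m < l.length by omega),
    List.getD_eq_getElem l 0 (show n < l.length by omega)]
  rcases hmn.eq_or_lt with rfl | hlt
  · exact Or.inr rfl
  · exact List.pairwise_iff_getElem.1 h _ _ _ _ hlt

theorem getD_infix (s w t : List (ℝ × ℝ)) {n : ℕ} (hn : n < w.length) :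
    (s ++ w ++ t).getD (s.length + n) 0 = w.getD n 0 := by
  rw [List.append_assoc, List.getD_append_right _ _ _ _ (by omega), Nat.add_sub_cancel_left,
    List.getD_append _ _ _ _ hn]

theorem WindowsPositive.dividedDiff_nonneg {k : ℕ} {f : ℝ → ℝ} {l : List (ℝ × ℝ)}
    (h : WindowsPositive k f l) {i : ℕ} (hi : i + k < l.length) :
    0 ≤ dividedDiff f (fun n => l.getD n 0) k i := by
  have hinf : (l.drop i).take (k + 1) <:+: l :=
    (List.take_prefix _ _).isInfix.trans (List.drop_suffix _ _).isInfix
  have hlen : ((l.drop i).take (k + 1)).length = k + 1 := by simp; omega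
  refine (h _ hinf hlen).2.trans_eq (dividedDiff_congr fun n hn => ?_)
  have : n < k + 1 := by omega
  simp [List.getD_eq_getElem?_getD, this]

theorem windowsPositive_of_dividedDiff_nonneg {k : ℕ} {f : ℝ → ℝ} {l : List (ℝ × ℝ)}
    (h : ∀ i, i + k < l.length → 0 ≤ dividedDiff f (fun n => l.getD n 0) k i) :
    WindowsPositive k f l := by
  rintro w ⟨s, t, rfl⟩ hw
  refine ⟨hw, (h s.length (by simp; omega)).trans_eq (dividedDiff_congr fun n hn => ?_)⟩
  rw [getD_infix s w t (by omega), zero_add]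

/-- A window avoiding the gap is an old window; one across the gap comes from k+2 consecutive old
terms by skipping one. -/
theorem WindowsPositive.delete {k : ℕ} {f : ℝ → ℝ} {s t : List (ℝ × ℝ)} {a : ℝ × ℝ}
    (h : WindowsPositive k f (s ++ a :: t)) (hl : (s ++ a :: t).Pairwise Precedes) :
    WindowsPositive k f (s ++ t) := by
  apply windowsPositive_of_dividedDiff_nonneg
  intro i hi
  have hlen : (s ++ a :: t).length = (s ++ t).length + 1 := by simp; omega
  set l := s ++ a :: t with hldef
  have hskip : ∀ n, (s ++ t).getD n 0 = skip (fun n => l.getD n 0) s.length n := by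
    intro n
    rw [skip, hldef]
    split_ifs with hn
    · rw [List.getD_append _ _ _ _ hn, List.getD_append _ _ _ _ hn]
    · rw [List.getD_append_right _ _ _ _ (by omega), List.getD_append_right _ _ _ _ (by omega),
        show n + 1 - s.length = n - s.length + 1 by omega, List.getD_cons_succ]
  simp only [hskip]
  rcases Nat.lt_or_ge s.length i with h1 | h1
  · have := h.dividedDiff_nonneg (i := i + 1) (by omega)
    refine this.trans_eq (dividedDiff_congr fun n hn => ?_)
    rw [skip, if_neg (by omega), show i + 1 + n = i + n + 1 by omega]
  rcases Nat.lt_or_ge (i + k + 1) s.length with h2 | h2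
  · have := h.dividedDiff_nonneg (i := i) (by omega)
    refine this.trans_eq (dividedDiff_congr fun n hn => ?_)
    rw [skip, if_pos (by omega)]
  exact (chainOn_getD hl (by omega)).dividedDiff_skip_nonneg h1 h2
    (h.dividedDiff_nonneg (by omega)) (h.dividedDiff_nonneg (by omega))

theorem WindowsPositive.append_sublist {k : ℕ} {f : ℝ → ℝ} {s l l' : List (ℝ × ℝ)}
    (hs : l'.Sublist l) (h : WindowsPositive k f (s ++ l)) (hl : (s ++ l).Pairwise Precedes) :
    WindowsPositive k f (s ++ l') := by
  induction hs generalizing s with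
  | slnil => exact h
  | cons a _ ih =>
    exact ih (h.delete hl) (hl.sublist (List.Sublist.append_left (List.sublist_cons_self _ _) s))
  | cons_cons a _ ih =>
    rw [List.append_cons] at h hl ⊢
    exact ih h hl

theorem WindowsPositive.isPositive_of_sublist {k : ℕ} {f : ℝ → ℝ} {l t : List (ℝ × ℝ)}
    (h : WindowsPositive k f l) (hl : l.Pairwise Precedes) (ht : t.Sublist l)
    (hk : t.length = k + 1) : IsPositive k f t :=
  (WindowsPositive.append_sublist (s := []) ht h hl) t (List.infix_refl t) hk

/-- A window meeting both outer lists would contain the middle one and so have at least k+2 terms.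
-/
theorem WindowsPositive.merge {k : ℕ} {f : ℝ → ℝ} {l₁ l l₂ : List (ℝ × ℝ)}
    (h₁ : WindowsPositive k f (l₁ ++ l)) (h₂ : WindowsPositive k f (l ++ l₂))
    (hk : k ≤ l.length) : WindowsPositive k f (l₁ ++ l ++ l₂) := by
  rintro w ⟨s, t, e⟩ hw
  rcases Nat.lt_or_ge s.length l₁.length with hs | hs
  · refine h₁ w ?_ hw
    have h3 : s ++ w <+: l₁ ++ l ++ l₂ := ⟨t, e⟩
    have h4 : s ++ w <+: l₁ ++ l :=
      List.prefix_of_prefix_length_le h3 (List.prefix_append _ _) (by simp; omega)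
    exact (List.suffix_append s w).isInfix.trans h4.isInfix
  · refine h₂ w ?_ hw
    have hle := congrArg List.length e
    simp only [List.length_append] at hle
    have h3 : w ++ t <:+ l₁ ++ l ++ l₂ := ⟨s, by rw [← e, List.append_assoc]⟩
    have h4 : w ++ t <:+ l ++ l₂ :=
      List.suffix_of_suffix_length_le h3 ⟨l₁, by rw [List.append_assoc]⟩ (by simp; omega)
    exact (List.prefix_append w t).isInfix.trans h4.isInfix

/-! ### Concatenation of k-monotone chains, and chains of one point -/

theorem pairwise_extendedChain {k : ℕ} {a b : ℝ} {l : List (ℝ × ℝ)}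
    (h : (gam k a :: (l ++ [gam k b])).Pairwise (fun p q => p.1 < q.1)) :
    (extendedChain k a b l).Pairwise Precedes := by
  rw [List.pairwise_cons, List.pairwise_append] at h
  obtain ⟨ha, hl, -, hb⟩ := h
  have hrep : ∀ q : ℝ × ℝ, (List.replicate k q).Pairwise Precedes := fun q =>
    List.pairwise_replicate.2 (Or.inr (Or.inr rfl))
  rw [extendedChain, List.pairwise_append, List.pairwise_append]
  refine ⟨⟨hrep _, hl.imp Or.inl, ?_⟩, hrep _, ?_⟩
  · intro p hp q hq
    rw [List.eq_of_mem_replicate hp]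
    exact Or.inl (ha q (by simp [hq]))
  · intro p hp q hq
    rw [List.eq_of_mem_replicate hq]
    rcases List.mem_append.1 hp with hp | hp
    · rw [List.eq_of_mem_replicate hp]
      exact Or.inl (ha _ (by simp))
    · exact Or.inl (hb p hp _ (by simp))

theorem isKMonotone_of_windowsPositive {k : ℕ} {a b : ℝ} {l : List (ℝ × ℝ)}
    (h : (gam k a :: (l ++ [gam k b])).Pairwise (fun p q => p.1 < q.1))
    (hw : WindowsPositive k (fun x => x ^ k) (extendedChain k a b l)) : IsKMonotone k a b l :=
  ⟨h, fun _ ht hk => hw.isPositive_of_sublist (pairwise_extendedChain h) ht hk⟩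

theorem IsKMonotone.windowsPositive {k : ℕ} {a b : ℝ} {l : List (ℝ × ℝ)}
    (h : IsKMonotone k a b l) : WindowsPositive k (fun x => x ^ k) (extendedChain k a b l) :=
  fun w hw hk => h.2 w hw.sublist hk

theorem IsKMonotone.sublist {k : ℕ} {a b : ℝ} {l l' : List (ℝ × ℝ)} (h : IsKMonotone k a b l)
    (hl : l'.Sublist l) : IsKMonotone k a b l' :=
  ⟨h.1.sublist ((List.Sublist.append_right hl _).cons_cons _), fun t ht =>
    h.2 t (ht.trans (List.Sublist.append_right (List.Sublist.append_left hl _) _))⟩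

theorem IsKMonotone.append {k : ℕ} {a b c : ℝ} {l₁ l₂ : List (ℝ × ℝ)}
    (h₁ : IsKMonotone k a b l₁) (h₂ : IsKMonotone k b c l₂) : IsKMonotone k a c (l₁ ++ l₂) := by
  have hw := h₁.windowsPositive.merge (l₂ := l₂ ++ List.replicate k (gam k c))
    (by simpa [extendedChain] using h₂.windowsPositive) (by simp)
  have p₁ : ((gam k a :: l₁) ++ [gam k b]).Pairwise (fun p q => p.1 < q.1) := h₁.1
  have p₂ := h₂.1
  have c₁ : ∀ p ∈ gam k a :: l₁, p.1 < b := fun p hp =>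
    (List.pairwise_append.1 p₁).2.2 p hp _ (List.mem_singleton_self _)
  have c₂ : ∀ q ∈ l₂ ++ [gam k c], b < q.1 := (List.pairwise_cons.1 p₂).1
  have hp : ((gam k a :: l₁) ++ (gam k b :: (l₂ ++ [gam k c]))).Pairwise
      (fun p q => p.1 < q.1) := by
    refine List.pairwise_append.2 ⟨(List.pairwise_append.1 p₁).1, p₂, fun p hp q hq => ?_⟩
    rcases List.mem_cons.1 hq with rfl | hq
    · exact c₁ p hp
    · exact (c₁ p hp).trans (c₂ q hq)
  have hp' : (extendedChain k a b l₁ ++ (l₂ ++ List.replicate k (gam k c))).Pairwise Precedes := by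
    have hsub : (l₂ ++ List.replicate k (gam k c)).Sublist (extendedChain k b c l₂) := by
      simp [extendedChain]
    refine List.pairwise_append.2 ⟨pairwise_extendedChain h₁.1,
      (pairwise_extendedChain p₂).sublist hsub, fun p hp q hq => ?_⟩
    have hpb : p.1 ≤ b := by
      simp only [extendedChain, List.mem_append, List.mem_replicate] at hp
      rcases hp with (⟨-, rfl⟩ | hp) | ⟨-, rfl⟩
      · exact (c₁ _ (by simp)).le
      · exact (c₁ p (by simp [hp])).le
      · exact le_rfl
    have hqb : b < q.1 := by
      simp only [List.mem_append, List.mem_replicate] at hq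
      rcases hq with hq | ⟨-, rfl⟩
      · exact c₂ q (by simp [hq])
      · exact c₂ _ (by simp)
    exact Or.inl (hpb.trans_lt hqb)
  -- The k copies of `gam k b` in the middle are now deleted.
  refine ⟨hp.sublist (by simp), fun t ht hk => ?_⟩
  refine hw.isPositive_of_sublist hp' (ht.trans ?_) hk
  simp [extendedChain]

/-- The i-th window holds k-i copies of `gam k a`, then p, then i copies of `gam k b`. The power
contributes 1 and the vertical offset of p the fraction. -/
theorem isKMonotone_singleton {k : ℕ} {a b : ℝ} {p : ℝ × ℝ} (ha : a < p.1) (hb : p.1 < b)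
    (h : ∀ i ≤ k, 0 ≤ 1 + (p.2 - p.1 ^ k) / ((p.1 - a) ^ (k - i) * (p.1 - b) ^ i)) :
    IsKMonotone k a b [p] := by
  apply isKMonotone_of_windowsPositive
  · simp [gam, ha, hb, ha.trans hb]
  apply windowsPositive_of_dividedDiff_nonneg
  intro i hi
  have hik : i ≤ k := by simp [extendedChain] at hi; omega
  set x : ℕ → ℝ := fun n => if n < k then a else if n = k then p.1 else b with hxdef
  set z : ℕ → ℝ := fun n => if n = k then p.2 - p.1 ^ k else 0 with hzdef
  have hx : Monotone x := by
    intro m n hmn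
    simp only [hxdef]
    split_ifs <;> first | linarith | omega
  have hc : ∀ n ≤ k, (extendedChain k a b [p]).getD (i + n) 0 =
      (fun n => (x n, x n ^ k + z n)) (i + n) := by
    intro n hn
    simp only [hxdef, hzdef, extendedChain]
    rcases lt_trichotomy (i + n) k with h1 | h1 | h1
    · rw [List.append_assoc, List.getD_append _ _ _ _ (by simpa using h1),
        List.getD_replicate _ h1]
      simp [gam, h1, h1.ne]
    · rw [h1, List.append_assoc, List.getD_append_right _ _ _ _ (by simp)]
      simp
    · rw [List.getD_append_right _ _ _ _ (by simp; omega), List.getD_replicate _ (by simp; omega)]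
      simp [gam, h1.ne', h1.not_gt]
  rw [dividedDiff_congr (q := fun n => (x n, x n ^ k + z n)) (i' := i) hc, dividedDiff_add, dividedDiff_pow_self hx]
  have := dividedDiff_zero_single (x := x) (z := z) (e := k) ha hb (fun n hn => by simp [hxdef, hn])
    (by simp [hxdef]) (fun n hn => by simp [hxdef, hn.ne', hn.not_gt])
    (fun n hn => by simp [hzdef, hn]) (k - i) i i (by omega)
  rw [show k - i + i = k by omega] at this
  rw [this]
  simpa [hzdef] using h i hik

theorem isKMonotone_map_range {k m : ℕ} {a : ℕ → ℝ} {p : ℕ → ℝ × ℝ}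
    (h : ∀ i ≤ m, IsKMonotone k (a i) (a (i + 1)) [p i]) :
    IsKMonotone k (a 0) (a (m + 1)) ((List.range (m + 1)).map p) := by
  induction m with
  | zero => simpa using h 0 le_rfl
  | succ m ih =>
    rw [List.range_succ, List.map_append]
    exact (ih fun i hi => h i (by omega)).append (h (m + 1) le_rfl)

end KMonotone
namespace KMonotone

/-! ### A subset of the cells -/

/-- The part of the interior of `C_k(a,b)` over the left half of `[a,b]`. -/
def halfCell (k : ℕ) (a b : ℝ) : Set (ℝ × ℝ) :=
  regionBetween (PhiPoly k a) (PsiPoly k a b) (Set.Ioo a ((a + b) / 2))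

theorem continuous_phiPoly (k : ℕ) (a : ℝ) : Continuous (PhiPoly k a) := by
  unfold PhiPoly; fun_prop

theorem continuous_psiPoly (k : ℕ) (a b : ℝ) : Continuous (PsiPoly k a b) := by
  unfold PsiPoly; fun_prop

theorem measurableSet_halfCell (k : ℕ) (a b : ℝ) : MeasurableSet (halfCell k a b) :=
  measurableSet_regionBetween (continuous_phiPoly k a).measurable
    (continuous_psiPoly k a b).measurable measurableSet_Ioo

/-- The vertical height is (b-a)(x-a)^(k-1). -/
theorem volume_halfCell {k : ℕ} (hk : 1 ≤ k) {a b : ℝ} (hab : a ≤ b) :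
    volume (halfCell k a b) = ENNReal.ofReal ((b - a) ^ (k + 1) / (2 ^ k * k)) := by
  obtain ⟨k, rfl⟩ : ∃ j, k = j + 1 := ⟨k - 1, by omega⟩
  have hdiff : ∀ x, PsiPoly (k + 1) a b x - PhiPoly (k + 1) a x = (b - a) * (x - a) ^ k := by
    intro x
    simp only [PsiPoly, PhiPoly, Nat.add_sub_cancel]
    ring
  have hint : ∀ f : ℝ → ℝ, Continuous f → IntegrableOn f (Set.Ioo a ((a + b) / 2)) := fun f hf =>
    (hf.integrableOn_Icc).mono_set Set.Ioo_subset_Icc_self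
  rw [halfCell, Measure.volume_eq_prod, volume_regionBetween_eq_integral
    (hint _ (continuous_phiPoly _ _)) (hint _ (continuous_psiPoly _ _ _)) measurableSet_Ioo]
  · congr 1
    simp only [Pi.sub_apply, hdiff]
    rw [← integral_Ioc_eq_integral_Ioo, ← intervalIntegral.integral_of_le (by linarith),
      intervalIntegral.integral_const_mul,
      intervalIntegral.integral_comp_sub_right (fun x => x ^ k), integral_pow,
      show (a + b) / 2 - a = (b - a) / 2 by ring, div_pow]
    push_cast
    field_simp
    simp
    ring
  · intro x hx
    have := mul_nonneg (sub_nonneg.2 hab) (pow_nonneg (sub_nonneg.2 hx.1.le) k)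
    linarith [hdiff x]

/-- With u = x-a and v = b-x, even i bounds y - x^k below by -u^(k-i) v^i and odd i bounds it above
by u^(k-i) v^i. On the left half u ≤ v, so i = 0 and i = 1 are the strictest; these are the two
bounding curves. -/
theorem isKMonotone_singleton_of_mem_halfCell {k : ℕ} (hk : 1 ≤ k) {a b : ℝ} {p : ℝ × ℝ}
    (hp : p ∈ halfCell k a b) : IsKMonotone k a b [p] := by
  obtain ⟨⟨h1, h2⟩, h3, h4⟩ := hp
  have hu : 0 < p.1 - a := by linarith
  have huv : p.1 - a ≤ b - p.1 := by linarith
  have hv : 0 < b - p.1 := by linarith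
  refine isKMonotone_singleton h1 (by linarith) fun i hi => ?_
  simp only [PhiPoly, PsiPoly] at h3 h4
  rw [show p.1 - b = -(b - p.1) by ring] at h4 ⊢
  set u := p.1 - a
  set v := b - p.1
  have hw : 0 < u ^ (k - i) * v ^ i := by positivity
  rcases Nat.even_or_odd i with he | ho
  · rw [he.neg_pow]
    have : u ^ k ≤ u ^ (k - i) * v ^ i := by
      calc u ^ k = u ^ (k - i) * u ^ i := by rw [← pow_add]; congr 1; omega
        _ ≤ _ := by gcongr
    rw [← neg_le_iff_add_nonneg', le_div_iff₀ hw]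
    linarith
  · rw [ho.neg_pow, mul_neg, div_neg, ← sub_eq_add_neg, sub_nonneg, div_le_one hw]
    have hi1 : 1 ≤ i := ho.pos
    have : u ^ (k - 1) * v ≤ u ^ (k - i) * v ^ i := by
      calc u ^ (k - 1) * v = u ^ (k - i) * (u ^ (i - 1) * v) := by
            rw [← mul_assoc, ← pow_add]; congr 2; omega
        _ ≤ u ^ (k - i) * (v ^ (i - 1) * v) := by gcongr
        _ = _ := by rw [← pow_succ]; congr 2; omega
    linarith

theorem isKMonotone_singleton_midpoint {k : ℕ} {a b : ℝ} (hab : a < b) :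
    IsKMonotone k a b [gam k ((a + b) / 2)] :=
  isKMonotone_singleton (by simp only [gam]; linarith) (by simp only [gam]; linarith)
    fun i _ => by simp [gam]

theorem halfCell_subset_cell {k : ℕ} (hk : 1 ≤ k) {a b a' b' : ℝ} (ha : a' ≤ a) (hb : b ≤ b') :
    halfCell k a b ⊆ cell k a' b' := by
  rintro p ⟨⟨h1, h2⟩, h3, h4⟩
  have hu : 0 < p.1 - a := by linarith
  have huv : p.1 - a ≤ b - p.1 := by linarith
  have hv : 0 < b - p.1 := by linarith
  have hU : p.1 - a ≤ p.1 - a' := by linarith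
  have hV : b - p.1 ≤ b' - p.1 := by linarith
  refine ⟨by linarith, by linarith, ?_⟩
  obtain ⟨k, rfl⟩ : ∃ j, k = j + 1 := ⟨k - 1, by omega⟩
  simp only [PhiPoly, PsiPoly, Nat.add_sub_cancel, max_le_iff, le_min_iff] at h3 h4 ⊢
  rw [show p.1 - b = -(b - p.1) by ring] at h4
  rw [show p.1 - b' = -(b' - p.1) by ring]
  have hU0 : 0 < p.1 - a' := by linarith
  have hV0 : 0 < b' - p.1 := by linarith
  set u := p.1 - a
  set v := b - p.1
  set U := p.1 - a'
  set V := b' - p.1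
  have e1 : u ^ (k + 1) ≤ U ^ (k + 1) := by gcongr
  have e2 : u ^ (k + 1) ≤ V ^ (k + 1) := by gcongr; linarith
  have e3 : u ^ k * v ≤ U ^ k * V := by gcongr
  have e4 : u ^ (k + 1) ≤ V ^ k * U := by rw [pow_succ]; gcongr; linarith
  have e5 : u ^ k * v ≤ V ^ (k + 1) := by rw [pow_succ]; gcongr; linarith
  split_ifs with hev
  · have hodd : Odd k := by rwa [Nat.even_add_one, Nat.not_even_iff_odd] at hev
    -- One factor u must remain to be compared with U, since v ≤ U can fail; oddness supplies it.
    have e6 : u ^ k * v ≤ V ^ k * U := by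
      obtain ⟨j, rfl⟩ : ∃ j, k = j + 1 := ⟨k - 1, by have := hodd.pos; omega⟩
      calc u ^ (j + 1) * v = u ^ j * v * u := by ring
        _ ≤ V ^ j * V * U := by gcongr; linarith
        _ = _ := by ring
    rw [hev.neg_pow, hodd.neg_pow]
    refine ⟨⟨?_, ?_⟩, ?_, ?_⟩ <;> linarith
  · have hodd : Odd (k + 1) := Nat.not_even_iff_odd.1 hev
    have hk' : Even k := by rwa [Nat.even_add_one, not_not] at hev
    rw [hodd.neg_pow, hk'.neg_pow]
    refine ⟨⟨?_, ?_⟩, ?_, ?_⟩ <;> linarith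

/-- The upper curve is at most x^k + x^(k-1)(1-x) = x^(k-1) ≤ 1. -/
theorem halfCell_subset_unitSquare {k : ℕ} (hk : 1 ≤ k) {a b : ℝ} (ha : 0 ≤ a) (hb : b ≤ 1) :
    halfCell k a b ⊆ Set.Icc 0 1 ×ˢ Set.Icc 0 1 := by
  rintro p ⟨⟨h1, h2⟩, h3, h4⟩
  obtain ⟨k, rfl⟩ : ∃ j, k = j + 1 := ⟨k - 1, by omega⟩
  have ht : 0 ≤ p.1 := by linarith
  have ht1 : p.1 ≤ 1 := by linarith
  simp only [PhiPoly, PsiPoly, Nat.add_sub_cancel] at h3 h4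
  have e1 : (p.1 - a) ^ (k + 1) ≤ p.1 ^ (k + 1) := by
    gcongr; linarith
  have e2 : (p.1 - a) ^ k * (b - p.1) ≤ p.1 ^ k * (1 - p.1) := by
    gcongr <;> linarith
  have e3 : p.1 ^ k ≤ 1 := pow_le_one₀ ht ht1
  refine ⟨⟨ht, ht1⟩, by linarith, ?_⟩
  rw [pow_succ] at h4
  linarith

/-! ### Counting occupied half cells -/

theorem length_le_longest {k : ℕ} {a b : ℝ} {S : Set (ℝ × ℝ)} {l : List (ℝ × ℝ)}
    (hS : ∀ p ∈ l, p ∈ S) (h : IsKMonotone k a b l) : (l.length : ℕ∞) ≤ longest k a b S :=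
  le_iSup₂_of_le (f := fun (l : List (ℝ × ℝ))
    (_ : (∀ p ∈ l, p ∈ S) ∧ IsKMonotone k a b l) => (l.length : ℕ∞)) l ⟨hS, h⟩ le_rfl

open Classical in
/-- If the interval `[a 0, a m]` is divided at `a 1, …, a (m - 1)`, then choosing a point of `S`
in each of the cells where this is possible gives a `k`-monotone chain. -/
theorem card_filter_le_longest {k m : ℕ} (hk : 1 ≤ k) {a : ℕ → ℝ} (ha : StrictMono a)
    (S : Set (ℝ × ℝ)) :
    (((Finset.range m).filter fun i => (S ∩ halfCell k (a i) (a (i + 1))).Nonempty).card : ℕ∞) ≤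
      longest k (a 0) (a m) S := by
  rcases m with _ | m
  · simp
  let p : ℕ → ℝ × ℝ := fun i =>
    if h : (S ∩ halfCell k (a i) (a (i + 1))).Nonempty then h.some
    else gam k ((a i + a (i + 1)) / 2)
  have hp : ∀ i ≤ m, IsKMonotone k (a i) (a (i + 1)) [p i] := by
    intro i _
    by_cases h : (S ∩ halfCell k (a i) (a (i + 1))).Nonempty
    · simp only [p, dif_pos h]
      exact isKMonotone_singleton_of_mem_halfCell hk h.some_mem.2
    · simp only [p, dif_neg h]
      exact isKMonotone_singleton_midpoint (ha (Nat.lt_succ_self i))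
  let I := (List.range (m + 1)).filter fun i => (S ∩ halfCell k (a i) (a (i + 1))).Nonempty
  have hI : (I.map p).length =
      ((Finset.range (m + 1)).filter fun i => (S ∩ halfCell k (a i) (a (i + 1))).Nonempty).card := by
    rw [List.length_map]
    rfl
  rw [← hI]
  refine length_le_longest (fun q hq => ?_)
    ((isKMonotone_map_range hp).sublist (List.filter_sublist.map p))
  obtain ⟨i, hi, rfl⟩ := List.mem_map.1 hq
  have h := of_decide_eq_true (List.mem_filter.1 hi).2
  simp only [p, dif_pos h]
  exact h.some_mem.1

/-- The expectation of `longest` is bounded below by the expected number of occupied cells. -/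
theorem mul_le_lintegral_longest {Ω : Type*} [MeasurableSpace Ω] {μ : Measure Ω}
    {S : Ω → Set (ℝ × ℝ)} {k m : ℕ} (hk : 1 ≤ k) {a : ℕ → ℝ} (ha : StrictMono a) {c : ℝ≥0∞}
    (hmeas : ∀ i < m, MeasurableSet {ω | (S ω ∩ halfCell k (a i) (a (i + 1))).Nonempty})
    (hc : ∀ i < m, c ≤ μ {ω | (S ω ∩ halfCell k (a i) (a (i + 1))).Nonempty}) :
    m * c ≤ ∫⁻ ω, (longest k (a 0) (a m) (S ω) : ℝ≥0∞) ∂μ := by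
  classical
  calc (m : ℝ≥0∞) * c = ∑ i ∈ Finset.range m, c := by simp
    _ ≤ ∑ i ∈ Finset.range m, μ {ω | (S ω ∩ halfCell k (a i) (a (i + 1))).Nonempty} :=
      Finset.sum_le_sum fun i hi => hc i (Finset.mem_range.1 hi)
    _ = ∑ i ∈ Finset.range m, ∫⁻ ω,
          {ω | (S ω ∩ halfCell k (a i) (a (i + 1))).Nonempty}.indicator 1 ω ∂μ :=
      Finset.sum_congr rfl fun i hi =>
        (lintegral_indicator_one (hmeas i (Finset.mem_range.1 hi))).symm
    _ = ∫⁻ ω, ∑ i ∈ Finset.range m,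
          {ω | (S ω ∩ halfCell k (a i) (a (i + 1))).Nonempty}.indicator 1 ω ∂μ :=
      (lintegral_finsetSum' _ fun i hi =>
        (measurable_one.indicator (hmeas i (Finset.mem_range.1 hi))).aemeasurable).symm
    _ ≤ _ := lintegral_mono fun ω => by
      refine le_trans (le_of_eq ?_)
        (ENat.toENNReal_le.2 (card_filter_le_longest (m := m) hk ha (S ω)))
      simp [Set.indicator_apply, Finset.sum_boole]

end KMonotone
namespace KMonotone

/-! ### Occupation probabilities -/

theorem exp_neg_le_third {t : ℝ} (ht : 3 / 2 ≤ t) : Real.exp (-t) ≤ 1 / 3 := by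
  have h := Real.quadratic_le_exp_of_nonneg (show (0 : ℝ) ≤ t by linarith)
  rw [Real.exp_neg, ← one_div]
  exact one_div_le_one_div_of_le (by norm_num) (by nlinarith)

/-- The right side is the area of a half cell of width 3; Bernoulli gives 3(3/2)^k/k ≥ 3(1+k/2)/k >
3/2. -/
theorem le_three_pow_div {k : ℕ} (hk : 1 ≤ k) : (3 / 2 : ℝ) ≤ 3 ^ (k + 1) / (2 ^ k * k) := by
  have hk' : (1 : ℝ) ≤ k := by exact_mod_cast hk
  have h : 1 + (k : ℝ) * (1 / 2) ≤ (1 + 1 / 2) ^ k := one_add_mul_le_pow (by norm_num) k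
  have h' : (1 + 1 / 2 : ℝ) ^ k * 2 ^ k = 3 ^ k := by rw [← mul_pow]; norm_num
  rw [le_div_iff₀ (by positivity), pow_succ, ← h']
  nlinarith [pow_pos (show (0 : ℝ) < 2 by norm_num) k]

theorem mul_le_expUniform {k m n : ℕ} (hk : 1 ≤ k) (hm : 1 ≤ m) (hn : (3 * m) ^ (k + 1) ≤ n) :
    m * ENNReal.ofReal (2 / 3) ≤ expUniform k n := by
  have hm' : (0 : ℝ) < m := by exact_mod_cast hm
  let a : ℕ → ℝ := fun i => i / m
  have ha : StrictMono a := fun i j hij => by simp only [a]; gcongr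
  have h0 : a 0 = 0 := by simp [a]
  have h1 : a m = 1 := by simp [a, hm'.ne']
  set μ : Measure (ℝ × ℝ) :=
    (volume : Measure (ℝ × ℝ)).restrict (Set.Icc 0 1 ×ˢ Set.Icc 0 1) with hμ
  have : IsProbabilityMeasure μ :=
    ⟨by rw [hμ, Measure.restrict_apply_univ, Measure.volume_eq_prod, Measure.prod_prod]; simp⟩
  have hset : ∀ i, {X : Fin n → ℝ × ℝ |
      (Set.range X ∩ halfCell k (a i) (a (i + 1))).Nonempty} =
      (Set.univ.pi fun _ => (halfCell k (a i) (a (i + 1)))ᶜ)ᶜ := by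
    intro i
    ext X
    simp [Set.Nonempty]
  have hmeas : ∀ i, MeasurableSet (Set.univ.pi fun _ : Fin n =>
      (halfCell k (a i) (a (i + 1)))ᶜ) := fun i =>
    MeasurableSet.univ_pi fun _ => (measurableSet_halfCell _ _ _).compl
  have := mul_le_lintegral_longest (m := m) (c := ENNReal.ofReal (2 / 3))
    (μ := Measure.pi fun _ : Fin n => μ) (S := fun X => Set.range X) hk ha
    (fun i _ => by rw [hset]; exact (hmeas i).compl) ?_
  · rwa [h0, h1] at this
  intro i hi
  have hlen : a (i + 1) - a i = 1 / m := by simp only [a]; push_cast; ring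
  have hai : a i ≤ a (i + 1) := ha.monotone (Nat.le_succ i)
  set A : ℝ := (1 / m : ℝ) ^ (k + 1) / (2 ^ k * k) with hA
  have hvol : μ (halfCell k (a i) (a (i + 1))) = ENNReal.ofReal A := by
    rw [hμ, Measure.restrict_apply (measurableSet_halfCell _ _ _), Set.inter_eq_left.2
      (halfCell_subset_unitSquare hk (h0 ▸ ha.monotone (Nat.zero_le i))
        (h1 ▸ ha.monotone (Nat.succ_le_of_lt hi))), volume_halfCell hk hai, hlen]
  have hA0 : 0 ≤ A := by positivity
  have hA1 : A ≤ 1 := by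
    rw [← ENNReal.ofReal_le_one, ← hvol]
    exact prob_le_one
  -- The expected number of sample points in a half cell; scaling by 3m turns width 1/m into width
  -- 3.
  have hnA : 3 / 2 ≤ n * A := by
    calc (3 / 2 : ℝ) ≤ 3 ^ (k + 1) / (2 ^ k * k) := le_three_pow_div hk
      _ = ((3 * m : ℝ) ^ (k + 1)) * A := by rw [hA, mul_div_assoc', ← mul_pow, mul_one_div, mul_div_cancel_right₀ _ hm'.ne']
      _ ≤ n * A := by gcongr; exact_mod_cast hn
  have hpow : (1 - A) ^ n ≤ 1 / 3 := by
    calc (1 - A) ^ n ≤ Real.exp (-A) ^ n :=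
          pow_le_pow_left₀ (by linarith) (Real.one_sub_le_exp_neg A) n
      _ = Real.exp (-(n * A)) := by rw [← Real.exp_nat_mul]; ring_nf
      _ ≤ 1 / 3 := exp_neg_le_third hnA
  rw [hset, prob_compl_eq_one_sub (hmeas i), Measure.pi_pi, Finset.prod_const, Finset.card_univ,
    Fintype.card_fin, prob_compl_eq_one_sub (measurableSet_halfCell _ _ _), hvol,
    ← ENNReal.ofReal_one, ← ENNReal.ofReal_sub _ hA0, ← ENNReal.ofReal_pow (by linarith),
    ← ENNReal.ofReal_sub _ (pow_nonneg (by linarith) n)]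
  exact ENNReal.ofReal_le_ofReal (by linarith)

theorem mul_le_expPoisson {Ω : Type*} [MeasurableSpace Ω] {P : Measure Ω} [IsProbabilityMeasure P]
    {Pts : Ω → Set (ℝ × ℝ)} (h : IsPoissonProcess P Pts) {k m : ℕ} (hk : 1 ≤ k) (hm : 1 ≤ m)
    {b : ℝ} (hb : 3 * m ≤ b) : m * ENNReal.ofReal (2 / 3) ≤ expPoisson P Pts k 0 b := by
  have hm' : (0 : ℝ) < m := by exact_mod_cast hm
  have hb0 : 0 < b / m := div_pos (by linarith) hm'
  have hb3 : 3 ≤ b / m := (le_div_iff₀ hm').2 hb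
  let a : ℕ → ℝ := fun i => i * (b / m)
  have ha : StrictMono a := fun i j hij => by simp only [a]; gcongr
  have h0 : a 0 = 0 := by simp [a]
  have h1 : a m = b := by simp only [a]; field_simp
  have hset : ∀ i < m, {ω | (Pts ω ∩ cell k 0 b ∩ halfCell k (a i) (a (i + 1))).Nonempty} =
      {ω | (Pts ω ∩ halfCell k (a i) (a (i + 1))).encard = ((0 : ℕ) : ℕ∞)}ᶜ := by
    intro i hi
    have hsub : halfCell k (a i) (a (i + 1)) ⊆ cell k 0 b :=
      halfCell_subset_cell hk (h0 ▸ ha.monotone (Nat.zero_le i))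
        (h1 ▸ ha.monotone (Nat.succ_le_of_lt hi))
    ext ω
    rw [Set.mem_ofPred_eq, Set.inter_assoc, Set.inter_eq_right.2 hsub]
    simp [Set.nonempty_iff_ne_empty]
  have hmeas : ∀ i, MeasurableSet
      {ω | (Pts ω ∩ halfCell k (a i) (a (i + 1))).encard = ((0 : ℕ) : ℕ∞)} := fun i =>
    h.measurable_count _ (measurableSet_halfCell _ _ _) (measurableSet_singleton _)
  have := mul_le_lintegral_longest (m := m) (c := ENNReal.ofReal (2 / 3))
    (μ := P) (S := fun ω => Pts ω ∩ cell k 0 b) hk ha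
    (fun i hi => by rw [hset i hi]; exact (hmeas i).compl) ?_
  · rwa [h0, h1] at this
  intro i hi
  have hlen : a (i + 1) - a i = b / m := by simp only [a]; push_cast; ring
  have hai : a i ≤ a (i + 1) := ha.monotone (Nat.le_succ i)
  have hvol := volume_halfCell hk hai
  rw [hlen] at hvol
  have hA : 3 / 2 ≤ (b / m) ^ (k + 1) / (2 ^ k * k) :=
    (le_three_pow_div hk).trans (by gcongr)
  rw [hset i hi, prob_compl_eq_one_sub (hmeas i), h.poisson_count _ (measurableSet_halfCell _ _ _)
    (by rw [hvol]; exact ENNReal.ofReal_ne_top), hvol, ENNReal.toReal_ofReal (by linarith)]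
  simp only [pow_zero, mul_one, Nat.factorial_zero, Nat.cast_one, div_one]
  rw [← ENNReal.ofReal_one, ← ENNReal.ofReal_sub _ (Real.exp_nonneg _)]
  exact ENNReal.ofReal_le_ofReal (by linarith [exp_neg_le_third hA])

/-! ### Choice of m and the constant 1/6 = (2/3)(1/4) -/

theorem ofReal_div_six_le {m : ℕ} {x : ℝ} {E : ℝ≥0∞} (hx : x ≤ 4 * m)
    (h : m * ENNReal.ofReal (2 / 3) ≤ E) : ENNReal.ofReal (x / 6) ≤ E := by
  refine le_trans ?_ h
  rw [← ENNReal.ofReal_natCast, ← ENNReal.ofReal_mul (Nat.cast_nonneg m)]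
  exact ENNReal.ofReal_le_ofReal (by linarith)

theorem eventually_le_expUniform {k : ℕ} (hk : 1 ≤ k) : ∀ᶠ n : ℕ in atTop,
    ENNReal.ofReal ((n : ℝ) ^ (1 / ((k : ℝ) + 1)) / 6) ≤ expUniform k n := by
  have hk0 : (0 : ℝ) < 1 / ((k : ℝ) + 1) := by positivity
  have ht := (tendsto_rpow_atTop hk0).comp (tendsto_natCast_atTop_atTop (R := ℝ))
  -- For N ≥ 12, m = ⌈N/4⌉ satisfies 3m ≤ 3N/4 + 3 ≤ N, as the cell bound requires.
  filter_upwards [ht.eventually_ge_atTop 12] with n hn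
  simp only [Function.comp_apply] at hn
  set N : ℝ := (n : ℝ) ^ (1 / ((k : ℝ) + 1)) with hN
  have hNn : N ^ (k + 1) = n := by
    rw [hN, ← Real.rpow_natCast, ← Real.rpow_mul (Nat.cast_nonneg n)]
    push_cast
    rw [one_div_mul_cancel (by positivity), Real.rpow_one]
  have h1 : N / 4 ≤ ⌈N / 4⌉₊ := Nat.le_ceil _
  have h2 : (⌈N / 4⌉₊ : ℝ) < N / 4 + 1 := Nat.ceil_lt_add_one (by linarith)
  refine ofReal_div_six_le (m := ⌈N / 4⌉₊) (by linarith)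
    (mul_le_expUniform hk (Nat.one_le_ceil_iff.2 (by linarith)) ?_)
  have h3 : (3 * (⌈N / 4⌉₊ : ℝ)) ^ (k + 1) ≤ N ^ (k + 1) := by gcongr; linarith
  rw [hNn] at h3
  exact_mod_cast h3

theorem eventually_le_expPoisson {Ω : Type*} [MeasurableSpace Ω] {P : Measure Ω}
    [IsProbabilityMeasure P] {Pts : Ω → Set (ℝ × ℝ)} (h : IsPoissonProcess P Pts) {k : ℕ}
    (hk : 1 ≤ k) : ∀ᶠ n : ℕ in atTop,
      ENNReal.ofReal ((n : ℝ) / 6) ≤ expPoisson P Pts k 0 (n : ℝ) := by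
  filter_upwards [eventually_ge_atTop 12] with n hn
  -- Natural-number division: n/3 rounds down, so the cells have width at least 3.
  refine ofReal_div_six_le (m := n / 3) ?_ (mul_le_expPoisson h hk (by omega) ?_)
  · exact_mod_cast (by omega : n ≤ 4 * (n / 3))
  · exact_mod_cast (by omega : 3 * (n / 3) ≤ n)

theorem one_sixth_le_of_tendsto {u v : ℕ → ℝ} {E : ℕ → ℝ≥0∞} {α : ℝ≥0}
    (huv : ∀ᶠ n in atTop, 0 ≤ u n ∧ u n * v n = 1)
    (hE : ∀ᶠ n in atTop, ENNReal.ofReal (v n / 6) ≤ E n)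
    (h : Tendsto (fun n => ENNReal.ofReal (u n) * E n) atTop (𝓝 (α : ℝ≥0∞))) : 1 / 6 ≤ α := by
  have key : ENNReal.ofReal (1 / 6) ≤ (α : ℝ≥0∞) := by
    refine ge_of_tendsto h ?_
    filter_upwards [huv, hE] with n h1 h2
    calc ENNReal.ofReal (1 / 6) = ENNReal.ofReal (u n) * ENNReal.ofReal (v n / 6) := by
          rw [← ENNReal.ofReal_mul h1.1, ← mul_div_assoc, h1.2]
      _ ≤ _ := by gcongr
  have key' : (1 / 6 : ℝ) ≤ α := by
    simpa using ENNReal.toReal_mono ENNReal.coe_ne_top key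
  exact_mod_cast key'

end KMonotone

theorem mainTheorem5 (k : ℕ) (hk : 1 ≤ k) :
    (∀ᶠ n : ℕ in atTop,
      ENNReal.ofReal ((n : ℝ) ^ (1 / ((k : ℝ) + 1)) / 6) ≤ KMonotone.expUniform k n) ∧
    (∀ α : ℝ≥0,
      Tendsto (fun n : ℕ =>
          ENNReal.ofReal ((n : ℝ) ^ (-(1 / ((k : ℝ) + 1)))) * KMonotone.expUniform k n)
        atTop (𝓝 (α : ℝ≥0∞)) →
      1 / 6 ≤ α) ∧
    (∀ (Ω : Type*) [MeasurableSpace Ω] (P : Measure Ω) [IsProbabilityMeasure P]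
      (Pts : Ω → Set (ℝ × ℝ)), KMonotone.IsPoissonProcess P Pts →
      (∀ᶠ n : ℕ in atTop,
        ENNReal.ofReal ((n : ℝ) / 6) ≤ KMonotone.expPoisson P Pts k 0 (n : ℝ)) ∧
      (∀ α : ℝ≥0,
        Tendsto (fun n : ℕ =>
            ENNReal.ofReal ((n : ℝ)⁻¹) * KMonotone.expPoisson P Pts k 0 (n : ℝ))
          atTop (𝓝 (α : ℝ≥0∞)) →
        1 / 6 ≤ α)) := by
  refine ⟨KMonotone.eventually_le_expUniform hk, fun α hα => ?_, fun Ω _ P _ Pts hP =>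
    ⟨KMonotone.eventually_le_expPoisson hP hk, fun α hα => ?_⟩⟩
  · refine KMonotone.one_sixth_le_of_tendsto ?_ (KMonotone.eventually_le_expUniform hk) hα
    filter_upwards [eventually_gt_atTop 0] with n hn
    have hn' : (0 : ℝ) < n := by exact_mod_cast hn
    exact ⟨by positivity, by rw [← Real.rpow_add hn', neg_add_cancel, Real.rpow_zero]⟩
  · refine KMonotone.one_sixth_le_of_tendsto ?_ (KMonotone.eventually_le_expPoisson hP hk) hα
    filter_upwards [eventually_gt_atTop 0] with n hn
    have hn' : (n : ℝ) ≠ 0 := by exact_mod_cast hn.ne'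
    exact ⟨by positivity, inv_mul_cancel₀ hn'⟩
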